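/- Let $n\ge 1$, let $S^{n-1}$ be the unit sphere of $\mathbb{R}^n$ with its spherical measure $du$, and let $\varphi,\phi:(0,\infty)\to(0,\infty)$ satisfy: A1) $\phi$ is strictly decreasing, with $\lim_{t\to 0^+}\phi(t)=\infty$ and $\lim_{t\to\infty}\phi(t)=0$; A2) the derivative $\phi'$ exists and is strictly negative on $(0,\infty)$; A3) $\varphi(t)=-\phi'(t)\,t$ for all $t>0$, and $\varphi$ is continuous on $(0,\infty)$. For a convex body $K\subset\mathbb{R}^n$ with the origin in its interior, let $h_K(u)=\max\{x\cdot u: x\in K\}$ and $\rho_K(u)=\max\{\lambda:\lambda u\in K\}$ for $u\in S^{n-1}$. For $\eta\subset S^{n-1}$ let $$\boldsymbol{\alpha}_K^*(\eta)=\{x/|x| : x\in\partial K,\ x\cdot v=h_K(v)\text{ for some }v\in\eta\},$$ and put $$\widetilde C_\varphi(K,\eta)=\frac1n\int_{\boldsymbol{\alpha}_K^*(\eta)}\varphi(\rho_K(u))\,du\quad(\eta\subset S^{n-1}\text{ Borel}),\qquad \widetilde V_\varphi(K)=\frac1n\int_{S^{n-1}}\varphi(\rho_K(u))\,du.$$ Let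 $\mu$ be a nonzero finite Borel measure on $S^{n-1}$ and $|\mu|=\mu(S^{n-1})$. Then the following statements are equivalent: (i) $\mu$ is not concentrated in any closed hemisphere, i.e. $\int_{S^{n-1}}\max\{\xi\cdot\theta,0\}\,d\mu(\theta)>0$ for all $\xi\in S^{n-1}$; (ii) there exists a convex body $K\subset\mathbb{R}^n$ with the origin in its interior such that $$\frac{\mu}{|\mu|}=\frac{\widetilde C_\varphi(K,\cdot)}{\widetilde V_\varphi(K)}\quad\text{on all Borel subsets of }S^{n-1}.$$ -/

import Mathlib

open MeasureTheory Metric Set Filter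
open scoped ENNReal Topology RealInnerProductSpace

noncomputable section

namespace DualOrlicz

/-- Euclidean space `ℝⁿ`. -/
abbrev E (n : ℕ) : Type := EuclideanSpace ℝ (Fin n)

/-- The unit sphere `S^{n-1}` of `ℝⁿ`, with its Borel σ-algebra. -/
abbrev S (n : ℕ) : Type := sphere (0 : E n) 1

/-- The spherical measure `du` on `S^{n-1}` (total mass `n` times the volume of the unit ball). -/
def sphericalMeasure (n : ℕ) : Measure (S n) := (volume : Measure (E n)).toSphere

/-- The support function `h_K(u) = max {x · u : x ∈ K}`. -/
def supportFn {n : ℕ} (K : ConvexBody (E n)) (u : S n) : ℝ :=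
  sSup {r : ℝ | ∃ x ∈ (K : Set (E n)), r = ⟪x, (u : E n)⟫}

/-- The radial function `ρ_K(u) = max {r : r u ∈ K}`. -/
def radialFn {n : ℕ} (K : ConvexBody (E n)) (u : S n) : ℝ :=
  sSup {r : ℝ | r • (u : E n) ∈ (K : Set (E n))}

/-- The supporting hyperplane `H(K, u) = {x : x · u = h_K(u)}`. -/
def supportingHyperplane {n : ℕ} (K : ConvexBody (E n)) (u : S n) : Set (E n) :=
  {x | ⟪x, (u : E n)⟫ = supportFn K u}

/-- The reverse radial Gauss image
`α*_K(η) = {x / |x| : x ∈ ∂K ∩ H(K, v) for some v ∈ η}`. -/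
def reverseRadialGaussImage {n : ℕ} (K : ConvexBody (E n)) (η : Set (S n)) : Set (S n) :=
  {u | ∃ x ∈ frontier (K : Set (E n)),
    (∃ v ∈ η, x ∈ supportingHyperplane K v) ∧ (u : E n) = ‖x‖⁻¹ • x}

/-- The dual Orlicz curvature measure
`C̃_φ(K, η) = (1/n) ∫_{α*_K(η)} φ(ρ_K(u)) du`, as a function of the Borel set `η`. -/
def dualCurvature {n : ℕ} (φ : ℝ → ℝ) (K : ConvexBody (E n)) (η : Set (S n)) : ℝ≥0∞ :=
  (n : ℝ≥0∞)⁻¹ *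
    ∫⁻ u in reverseRadialGaussImage K η, ENNReal.ofReal (φ (radialFn K u)) ∂(sphericalMeasure n)

/-- The dual Orlicz quermassintegral `Ṽ_φ(K) = (1/n) ∫_{S^{n-1}} φ(ρ_K(u)) du`. -/
def dualQuermass {n : ℕ} (φ : ℝ → ℝ) (K : ConvexBody (E n)) : ℝ≥0∞ :=
  (n : ℝ≥0∞)⁻¹ * ∫⁻ u, ENNReal.ofReal (φ (radialFn K u)) ∂(sphericalMeasure n)

/-- The standing conditions on `φ` and its companion `ϕ`, both being functions on `(0, ∞)`; their
values outside `(0, ∞)` are irrelevant. That `φ` is positive on `(0, ∞)` follows from `deriv_neg`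
and `eq_neg_deriv_mul`. -/
structure Conditions (φ ϕ : ℝ → ℝ) : Prop where
  pos : ∀ t, 0 < t → 0 < ϕ t
  strictAntiOn : StrictAntiOn ϕ (Ioi 0)
  tendsto_zero : Tendsto ϕ (𝓝[>] 0) atTop
  tendsto_atTop : Tendsto ϕ atTop (𝓝 0)
  differentiableAt : ∀ t, 0 < t → DifferentiableAt ℝ ϕ t
  deriv_neg : ∀ t, 0 < t → deriv ϕ t < 0
  eq_neg_deriv_mul : ∀ t, 0 < t → φ t = -deriv ϕ t * t
  continuousOn : ContinuousOn φ (Ioi 0)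

/-- `μ` is not concentrated in any closed hemisphere: `∫ (ξ · θ)₊ dμ(θ) > 0` for all unit `ξ`. -/
def NotConcentrated {n : ℕ} (μ : Measure (S n)) : Prop :=
  ∀ ξ : S n, 0 < ∫ θ : S n, max ⟪(ξ : E n), (θ : E n)⟫ 0 ∂μ

end DualOrlicz

end

/-! For (i) ⇒ (ii) the body is found by maximization. Let `g` be the logarithm of a positive
continuous function on the sphere, `h` the support function of the star body with radial function
`exp ∘ g`, and `logEnvelope g = log h`. The polar body `{h ≤ 1}` (`unitBody`) has radial function
`exp (-logEnvelope g)`. With `Ψ s = ϕ (exp (-s))`, condition A3 says `Ψ' s = φ (exp (-s))`. Maximize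
`∫ g dμ` subject to `∫ Ψ (logEnvelope g) ≤ c` over the sphere. The constraint bounds `g` above
(`exists_bound_of_integral_le`). If moreover `∫ g dμ ≥ 0`, non-concentration of `μ` bounds
`logEnvelope g` below (`logEnvelope_lower_bound`). Replacing `g` by `convexify g` keeps the
constraint, does not lower the objective and gives a uniform Lipschitz bound, so Arzelà–Ascoli
yields a maximizer (`exists_maximizer`). At almost every `u` the function `h` is differentiable, its
gradient direction `normalDir g u` is the only maximizer in the definition of `h`, and the
derivative of `logEnvelope (g + t • k) u` at `t = 0` is `k (normalDir g u)`. The Euler–Lagrange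
condition makes `μ` proportional to the pushforward of `φ(ρ) du` under `normalDir g`. Since
`normalDir g u` is almost everywhere the outer normal of the polar body in the radial direction `u`,
this pushforward is its dual curvature measure up to the factor `n`. For (ii) ⇒ (i), the dual
curvature measure charges every open hemisphere (`dualCurvature_openHemisphere_pos`). -/

noncomputable section

namespace DualOrlicz

variable {n : ℕ}

/-! ### Log-envelopes and convexification -/

/-- The support function of the star-shaped set with radial function `exp ∘ g`. -/
def envelope (g : C(S n, ℝ)) (x : E n) : ℝ :=
  ⨆ v : S n, Real.exp (g v) * ⟪x, (v : E n)⟫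

lemma norm_sphere (u : S n) : ‖(u : E n)‖ = 1 := by
  simp

lemma inner_self_sphere (u : S n) : ⟪(u : E n), (u : E n)⟫ = 1 := by
  rw [real_inner_self_eq_norm_sq, norm_sphere, one_pow]

lemma inner_sphere_le (x : E n) (v : S n) : ⟪x, (v : E n)⟫ ≤ ‖x‖ := by
  simpa [norm_sphere] using real_inner_le_norm x (v : E n)

lemma exists_envelope_eq [Nonempty (S n)] (g : C(S n, ℝ)) (x : E n) :
    (∀ v : S n, Real.exp (g v) * ⟪x, (v : E n)⟫ ≤ envelope g x) ∧
      ∃ v : S n, Real.exp (g v) * ⟪x, (v : E n)⟫ = envelope g x := by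
  have hc : Continuous fun v : S n => Real.exp (g v) * ⟪x, (v : E n)⟫ := by fun_prop
  obtain ⟨v, -, hv⟩ := isCompact_univ.exists_isMaxOn univ_nonempty hc.continuousOn
  have hv' : ∀ w : S n, Real.exp (g w) * ⟪x, (w : E n)⟫ ≤ Real.exp (g v) * ⟪x, (v : E n)⟫ :=
    fun w => hv (mem_univ w)
  have he : envelope g x = Real.exp (g v) * ⟪x, (v : E n)⟫ :=
    le_antisymm (ciSup_le hv') (le_ciSup (f := fun w : S n => Real.exp (g w) * ⟪x, (w : E n)⟫)
      ⟨_, forall_mem_range.2 hv'⟩ v)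
  exact ⟨fun w => he ▸ hv' w, v, he.symm⟩

lemma envelope_smul (g : C(S n, ℝ)) {t : ℝ} (ht : 0 ≤ t) (x : E n) :
    envelope g (t • x) = t * envelope g x := by
  unfold envelope
  rw [Real.mul_iSup_of_nonneg ht]
  congr 1
  ext v
  rw [real_inner_smul_left]
  ring

lemma exists_upper_bound (g : C(S n, ℝ)) : ∃ b, ∀ v, g v ≤ b :=
  ⟨‖g‖, fun v => (le_abs_self _).trans (g.norm_coe_le_norm v)⟩

section Envelope

variable [Nonempty (S n)]

lemma le_envelope (g : C(S n, ℝ)) (x : E n) (v : S n) :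
    Real.exp (g v) * ⟪x, (v : E n)⟫ ≤ envelope g x := (exists_envelope_eq g x).1 v

lemma envelope_le {g : C(S n, ℝ)} {x : E n} {a : ℝ}
    (h : ∀ v : S n, Real.exp (g v) * ⟪x, (v : E n)⟫ ≤ a) : envelope g x ≤ a := ciSup_le h

lemma envelope_add_le (g : C(S n, ℝ)) (x y : E n) :
    envelope g (x + y) ≤ envelope g x + envelope g y :=
  envelope_le fun v => by
    rw [inner_add_left, mul_add]
    exact add_le_add (le_envelope g x v) (le_envelope g y v)

lemma envelope_le_mul_norm {g : C(S n, ℝ)} {b : ℝ} (hb : ∀ v, g v ≤ b) (x : E n) :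
    envelope g x ≤ Real.exp b * ‖x‖ :=
  envelope_le fun v => by
    calc Real.exp (g v) * ⟪x, (v : E n)⟫ ≤ Real.exp (g v) * ‖x‖ := by
          gcongr; exact inner_sphere_le x v
      _ ≤ Real.exp b * ‖x‖ := by gcongr; exact hb v

lemma envelope_sub_le {g : C(S n, ℝ)} {b : ℝ} (hb : ∀ v, g v ≤ b) (x y : E n) :
    envelope g x - envelope g y ≤ Real.exp b * ‖x - y‖ := by
  have h := envelope_add_le g y (x - y)
  rw [add_sub_cancel] at h
  linarith [envelope_le_mul_norm hb (x - y)]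

lemma lipschitzWith_envelope (g : C(S n, ℝ)) :
    ∃ C, LipschitzWith C (envelope g) := by
  obtain ⟨b, hb⟩ := exists_upper_bound g
  refine ⟨(Real.exp b).toNNReal, LipschitzWith.of_le_add_mul _ fun x y => ?_⟩
  rw [dist_eq_norm]
  have := envelope_sub_le hb x y
  rw [Real.coe_toNNReal _ (Real.exp_pos _).le]
  linarith

lemma exp_le_envelope (g : C(S n, ℝ)) (u : S n) : Real.exp (g u) ≤ envelope g u := by
  simpa only [inner_self_sphere, mul_one] using le_envelope g (u : E n) u

lemma envelope_pos (g : C(S n, ℝ)) (u : S n) : 0 < envelope g u :=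
  (Real.exp_pos _).trans_le (exp_le_envelope g u)

lemma envelope_pos_of_ne_zero (g : C(S n, ℝ)) {x : E n} (hx : x ≠ 0) : 0 < envelope g x := by
  have hx' : 0 < ‖x‖ := norm_pos_iff.2 hx
  let u : S n := ⟨‖x‖⁻¹ • x, by simp [norm_smul, hx]⟩
  have : x = ‖x‖ • (u : E n) := by simp [u, smul_smul, hx]
  rw [this, envelope_smul g hx'.le]
  exact mul_pos hx' (envelope_pos g u)

/-- The logarithm of the support function of the star-shaped set with radial function
`exp ∘ g`. -/
def logEnvelope (g : C(S n, ℝ)) : C(S n, ℝ) where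
  toFun u := Real.log (envelope g u)
  continuous_toFun := by
    obtain ⟨C, hC⟩ := lipschitzWith_envelope g
    exact (hC.continuous.comp continuous_subtype_val).log fun u => (envelope_pos g u).ne'

lemma exp_logEnvelope (g : C(S n, ℝ)) (u : S n) :
    Real.exp (logEnvelope g u) = envelope g u := Real.exp_log (envelope_pos g u)

lemma exp_mul_inner_le (g : C(S n, ℝ)) (u v : S n) :
    Real.exp (g v) * ⟪(u : E n), (v : E n)⟫ ≤ Real.exp (logEnvelope g u) := by
  rw [exp_logEnvelope]; exact le_envelope g u v

lemma exists_exp_mul_inner_eq (g : C(S n, ℝ)) (u : S n) :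
    ∃ v : S n, Real.exp (g v) * ⟪(u : E n), (v : E n)⟫ = Real.exp (logEnvelope g u) := by
  rw [exp_logEnvelope]; exact (exists_envelope_eq g u).2

lemma le_logEnvelope (g : C(S n, ℝ)) (u : S n) : g u ≤ logEnvelope g u := by
  rw [← Real.exp_le_exp, exp_logEnvelope]; exact exp_le_envelope g u

/-- Comparison of log-envelopes at `u` through a maximizer of the first one. -/
lemma logEnvelope_le_add {g g' : C(S n, ℝ)} {u v : S n} {d : ℝ}
    (hv : Real.exp (g v) * ⟪(u : E n), (v : E n)⟫ = Real.exp (logEnvelope g u))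
    (h : g v ≤ g' v + d) : logEnvelope g u ≤ logEnvelope g' u + d := by
  have hpos : 0 < ⟪(u : E n), (v : E n)⟫ := by
    have := Real.exp_pos (logEnvelope g u)
    rw [← hv] at this
    exact pos_of_mul_pos_right this (Real.exp_pos _).le
  rw [← Real.exp_le_exp, ← hv]
  calc Real.exp (g v) * ⟪(u : E n), (v : E n)⟫
      ≤ Real.exp (g' v + d) * ⟪(u : E n), (v : E n)⟫ := by gcongr
    _ = Real.exp d * (Real.exp (g' v) * ⟪(u : E n), (v : E n)⟫) := by rw [Real.exp_add]; ring
    _ ≤ Real.exp d * Real.exp (logEnvelope g' u) := by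
        gcongr; exact exp_mul_inner_le g' u v
    _ = _ := by rw [Real.exp_add]; ring

lemma logEnvelope_mono {g g' : C(S n, ℝ)} (h : ∀ v, g v ≤ g' v) (u : S n) :
    logEnvelope g u ≤ logEnvelope g' u := by
  obtain ⟨v, hv⟩ := exists_exp_mul_inner_eq g u
  simpa using logEnvelope_le_add (d := 0) hv (by simpa using h v)

lemma logEnvelope_le {g : C(S n, ℝ)} {b : ℝ} (hb : ∀ v, g v ≤ b) (u : S n) :
    logEnvelope g u ≤ b := by
  rw [← Real.exp_le_exp, exp_logEnvelope]
  simpa [norm_sphere] using envelope_le_mul_norm hb (u : E n)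

lemma dist_logEnvelope_le (g g' : C(S n, ℝ)) (u : S n) :
    |logEnvelope g u - logEnvelope g' u| ≤ dist g g' := by
  have key : ∀ g g' : C(S n, ℝ), logEnvelope g u - logEnvelope g' u ≤ dist g g' := by
    intro g g'
    obtain ⟨v, hv⟩ := exists_exp_mul_inner_eq g u
    have h1 := (abs_le.1 (Real.dist_eq _ _ ▸ ContinuousMap.dist_apply_le_dist (f := g) (g := g') v)).2
    linarith [logEnvelope_le_add (g' := g') (d := dist g g') hv (by linarith)]
  rw [abs_le]
  have := key g' g
  rw [dist_comm] at this
  exact ⟨by linarith, key g g'⟩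

lemma continuous_logEnvelope : Continuous (logEnvelope : C(S n, ℝ) → C(S n, ℝ)) := by
  refine (LipschitzWith.of_dist_le_mul (K := 1) fun g g' => ?_).continuous
  rw [NNReal.coe_one, one_mul, ContinuousMap.dist_le dist_nonneg]
  intro u
  rw [Real.dist_eq]
  exact dist_logEnvelope_le g g' u

/-- This is the bipolar inequality: `exp (g v) * ⟪u, v⟫ ≤ h u` can be read as a bound on `g v` that
involves `h` alone. -/
lemma logEnvelope_neg_le (g : C(S n, ℝ)) (v : S n) :
    logEnvelope (-logEnvelope g) v ≤ -g v := by
  rw [← Real.exp_le_exp]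
  obtain ⟨u, hu⟩ := exists_exp_mul_inner_eq (-logEnvelope g) v
  rw [← hu, ContinuousMap.neg_apply, Real.exp_neg, Real.exp_neg, inv_mul_le_iff₀ (Real.exp_pos _),
    ← div_eq_mul_inv, le_div_iff₀ (Real.exp_pos _), mul_comm, real_inner_comm]
  exact exp_mul_inner_le g u v

/-- The logarithm of the radial function of the closed convex hull of the star-shaped set with
radial function `exp ∘ g`. -/
def convexify (g : C(S n, ℝ)) : C(S n, ℝ) := -logEnvelope (-logEnvelope g)

lemma le_convexify (g : C(S n, ℝ)) (v : S n) : g v ≤ convexify g v := by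
  have := logEnvelope_neg_le g v
  simp only [convexify, ContinuousMap.neg_apply]
  linarith

/-- As for any Galois connection: one inequality is monotonicity, the other is the bipolar
inequality applied to `-logEnvelope g`. -/
lemma logEnvelope_convexify (g : C(S n, ℝ)) : logEnvelope (convexify g) = logEnvelope g := by
  ext u
  refine le_antisymm ?_ (logEnvelope_mono (le_convexify g) u)
  have := logEnvelope_neg_le (-logEnvelope g) u
  simpa [convexify] using this

lemma convexify_mem_Icc {g : C(S n, ℝ)} {a b : ℝ} (h : ∀ u, logEnvelope g u ∈ Icc a b) (v : S n) :
    convexify g v ∈ Icc a b := by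
  have h1 := logEnvelope_le (g := -logEnvelope g) (b := -a) (fun u => neg_le_neg (h u).1) v
  have h2 := le_logEnvelope (-logEnvelope g) v
  simp only [convexify, ContinuousMap.neg_apply] at *
  exact ⟨by linarith, by linarith [(h v).2]⟩

/-- The envelope is `exp b`-Lipschitz and at least `exp a` on the sphere, so its logarithm has the
quotient as Lipschitz constant. -/
lemma lipschitzWith_logEnvelope {g : C(S n, ℝ)} {a b : ℝ} (h : ∀ u, g u ∈ Icc a b) :
    LipschitzWith (Real.exp (b - a)).toNNReal (logEnvelope g) := by
  refine LipschitzWith.of_le_add_mul _ fun u w => ?_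
  have h1 := envelope_sub_le (fun v => (h v).2) (u : E n) w
  have ha : Real.exp a ≤ envelope g w :=
    (Real.exp_le_exp.2 (h w).1).trans (exp_le_envelope g w)
  have hw := envelope_pos g w
  have h2 : Real.log (envelope g u) - Real.log (envelope g w) ≤ envelope g u / envelope g w - 1 := by
    rw [← Real.log_div (envelope_pos g u).ne' hw.ne']
    exact Real.log_le_sub_one_of_pos (div_pos (envelope_pos g u) hw)
  have h3 : envelope g u / envelope g w - 1 ≤ Real.exp (b - a) * dist u w := by
    rw [div_sub_one hw.ne', div_le_iff₀ hw, Subtype.dist_eq, dist_eq_norm]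
    calc _ ≤ _ := h1
      _ = Real.exp (b - a) * ‖(u : E n) - w‖ * Real.exp a := by
        rw [Real.exp_sub]; field_simp
      _ ≤ _ := by gcongr
  rw [Real.coe_toNNReal _ (Real.exp_pos _).le]
  change Real.log (envelope g u) ≤ Real.log (envelope g w) + _
  linarith

lemma lipschitzWith_convexify {g : C(S n, ℝ)} {a b : ℝ} (h : ∀ u, logEnvelope g u ∈ Icc a b) :
    LipschitzWith (Real.exp (b - a)).toNNReal (convexify g) := by
  have := lipschitzWith_logEnvelope (g := -logEnvelope g) (a := -b) (b := -a)
    fun u => ⟨neg_le_neg (h u).2, neg_le_neg (h u).1⟩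
  rw [neg_sub_neg] at this
  exact this.neg

end Envelope

/-! ### Integration and compactness on the sphere -/

lemma continuous_max_inner (ξ : E n) :
    Continuous fun θ : S n => max ⟪ξ, (θ : E n)⟫ 0 := by fun_prop

lemma max_inner_mem_Icc (u v : S n) : max ⟪(u : E n), (v : E n)⟫ 0 ∈ Icc (0 : ℝ) 1 :=
  ⟨le_max_right _ _, max_le (by simpa [norm_sphere] using inner_sphere_le (u : E n) v) zero_le_one⟩

lemma integrable_of_continuous {μ : Measure (S n)} [IsFiniteMeasure μ] {f : S n → ℝ}
    (hf : Continuous f) : Integrable f μ :=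
  hf.integrable_of_hasCompactSupport (HasCompactSupport.of_compactSpace f)

lemma integrable_comp_continuousMap {μ : Measure (S n)} [IsFiniteMeasure μ] {Ψ : ℝ → ℝ}
    (hΨ : Continuous Ψ) (f : C(S n, ℝ)) : Integrable (fun u => Ψ (f u)) μ :=
  integrable_of_continuous (hΨ.comp f.continuous)

lemma notConcentrated_sphericalMeasure : NotConcentrated (sphericalMeasure n) := by
  intro ξ
  have : IsFiniteMeasure (sphericalMeasure n) := by unfold sphericalMeasure; infer_instance
  have : (sphericalMeasure n).IsOpenPosMeasure := by unfold sphericalMeasure; infer_instance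
  have hc := continuous_max_inner (ξ : E n)
  refine hc.integral_pos_of_hasCompactSupport_nonneg_nonzero
    (HasCompactSupport.of_compactSpace _) (fun θ => le_max_right _ _) (x := ξ) ?_
  rw [inner_self_sphere]
  norm_num

lemma NotConcentrated.exists_lower_bound [Nonempty (S n)] {μ : Measure (S n)} [IsFiniteMeasure μ]
    (h : NotConcentrated μ) :
    ∃ m, 0 < m ∧ ∀ u : S n, m ≤ ∫ v : S n, max ⟪(u : E n), (v : E n)⟫ 0 ∂μ := by
  have hc : Continuous fun u : S n => ∫ v : S n, max ⟪(u : E n), (v : E n)⟫ 0 ∂μ := by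
    refine continuous_of_dominated (bound := fun _ => 1)
      (fun u => (continuous_max_inner (u : E n)).aestronglyMeasurable)
      (fun u => Eventually.of_forall fun v => ?_) (integrable_const _)
      (Eventually.of_forall fun v => by fun_prop)
    rw [Real.norm_of_nonneg (max_inner_mem_Icc u v).1]
    exact (max_inner_mem_Icc u v).2
  obtain ⟨u, -, hu⟩ := isCompact_univ.exists_isMinOn univ_nonempty hc.continuousOn
  exact ⟨_, h u, fun w => hu (mem_univ w)⟩

lemma isCompact_lipschitz_Icc (a b : ℝ) (C : NNReal) :
    IsCompact {g : C(S n, ℝ) | (∀ v, g v ∈ Icc a b) ∧ LipschitzWith C g} := by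
  refine ArzelaAscoli.isCompact_of_equicontinuous _ ?_ ?_
  · have heq : ContinuousMap.toFun '' {g : C(S n, ℝ) | (∀ v, g v ∈ Icc a b) ∧ LipschitzWith C g} =
        (univ.pi fun _ => Icc a b) ∩ {f : S n → ℝ | LipschitzWith C f} := by
      ext f
      constructor
      · rintro ⟨g, hg, rfl⟩
        exact ⟨fun v _ => hg.1 v, hg.2⟩
      · rintro ⟨h1, h2⟩
        exact ⟨⟨f, h2.continuous⟩, ⟨fun v => h1 v (mem_univ v), h2⟩, rfl⟩
    rw [heq]
    exact (isCompact_univ_pi fun _ => isCompact_Icc).inter_right (isClosed_setOfPred_lipschitzWith C)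
  · exact (LipschitzWith.uniformEquicontinuous _ C fun g => g.2.2).equicontinuous

lemma continuous_integral (μ : Measure (S n)) [IsFiniteMeasure μ] :
    Continuous fun g : C(S n, ℝ) => ∫ v, g v ∂μ := by
  refine (LipschitzWith.of_dist_le_mul (K := (μ.real univ).toNNReal) fun g g' => ?_).continuous
  rw [dist_eq_norm, ← integral_sub (integrable_of_continuous g.continuous)
    (integrable_of_continuous g'.continuous), Real.coe_toNNReal _ measureReal_nonneg, mul_comm]
  refine norm_integral_le_of_norm_le_const (Eventually.of_forall fun v => ?_)
  rw [← dist_eq_norm]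
  exact ContinuousMap.dist_apply_le_dist v

/-! ### A priori bounds and existence of a maximizer -/

section Bounds

variable [Nonempty (S n)]

/-- With `s = logEnvelope g u`, a very negative `s` forces `⟪u, v⟫₊` to be small wherever `g v` is
not close to `s`. The pointwise bound by `(b - g v + 1) / (b - s + 1)` is linear in `g`, so
integrating it against `μ` bounds `b - s + 1`. -/
lemma logEnvelope_lower_bound {μ : Measure (S n)} [IsFiniteMeasure μ] {m b : ℝ} (hm : 0 < m)
    (hμ : ∀ u : S n, m ≤ ∫ v : S n, max ⟪(u : E n), (v : E n)⟫ 0 ∂μ) {g : C(S n, ℝ)}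
    (hb : ∀ v, g v ≤ b) (hg : 0 ≤ ∫ v, g v ∂μ) (u : S n) :
    b + 1 - (b + 1) * μ.real univ / m ≤ logEnvelope g u := by
  set s := logEnvelope g u with hs
  have hsb : s ≤ b := logEnvelope_le hb u
  have hz : 0 < b - s + 1 := by linarith
  have key : ∀ v : S n, max ⟪(u : E n), (v : E n)⟫ 0 ≤ (b - g v + 1) / (b - s + 1) := by
    intro v
    have hy : 0 ≤ b - g v := sub_nonneg.2 (hb v)
    rw [le_div_iff₀ hz]
    have h01 := max_inner_mem_Icc u v
    by_cases hcase : s ≤ g v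
    -- Here `⟪u, v⟫₊ ≤ exp (-(g v - s)) ≤ 1 / (1 + (g v - s))`; split `b - s + 1` as `(b - g v) + (1
    -- + (g v - s))`.
    · have h1 : max ⟪(u : E n), (v : E n)⟫ 0 ≤ Real.exp (-(g v - s)) := by
        refine max_le ?_ (Real.exp_pos _).le
        have := exp_mul_inner_le g u v
        rw [neg_sub, Real.exp_sub, le_div_iff₀ (Real.exp_pos _), mul_comm]
        exact this
      have h2 : Real.exp (-(g v - s)) * (1 + (g v - s)) ≤ 1 := by
        rw [Real.exp_neg, inv_mul_le_iff₀ (Real.exp_pos _), mul_one, add_comm]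
        exact Real.add_one_le_exp _
      have h3 : max ⟪(u : E n), (v : E n)⟫ 0 * (1 + (g v - s)) ≤ 1 :=
        (mul_le_mul_of_nonneg_right h1 (by linarith)).trans h2
      nlinarith [h01.1, h01.2]
    · push Not at hcase
      nlinarith [h01.1, h01.2]
  have hint : Integrable (fun v => g v) μ := integrable_of_continuous g.continuous
  have h1 : m ≤ ∫ v, (b - g v + 1) / (b - s + 1) ∂μ :=
    (hμ u).trans (integral_mono (integrable_of_continuous (continuous_max_inner _))
      (integrable_of_continuous (by fun_prop)) key)
  have h2 : ∫ v, (b - g v + 1) / (b - s + 1) ∂μ =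
      ((b + 1) * μ.real univ - ∫ v, g v ∂μ) / (b - s + 1) := by
    rw [integral_div]
    congr 1
    have : (fun v => b - g v + 1) = fun v => (b + 1) - g v := by ext v; ring
    rw [this, integral_sub (integrable_const _) hint, integral_const, smul_eq_mul, mul_comm]
  rw [h2, le_div_iff₀ hz] at h1
  have h3 : b - s + 1 ≤ (b + 1) * μ.real univ / m := by
    rw [le_div_iff₀ hm]; linarith
  linarith

/-- A large value `g v` makes the log-envelope large on the cap of directions `u` with `⟪u, v⟫ > exp
q`. This cap has a definite share of `σ`, uniformly in `v`. -/
lemma exists_bound_of_integral_le {σ : Measure (S n)} [IsFiniteMeasure σ] (hσ : NotConcentrated σ)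
    {Ψ : ℝ → ℝ} (hc : Continuous Ψ) (hpos : ∀ t, 0 < Ψ t) (hmono : Monotone Ψ)
    (htop : Tendsto Ψ atTop atTop) (c : ℝ) :
    ∃ b, ∀ g : C(S n, ℝ), ∫ u, Ψ (logEnvelope g u) ∂σ ≤ c → ∀ v, g v ≤ b := by
  obtain ⟨m, hm, hmσ⟩ := hσ.exists_lower_bound
  set A := σ.real univ with hA
  have hA0 : 0 ≤ A := measureReal_nonneg
  -- The threshold `exp q` costs at most half of the lower bound `m` after integration over `σ`.
  obtain ⟨q, hq⟩ : ∃ q, Real.exp q * A < m / 2 := by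
    refine ⟨Real.log (m / (2 * (A + 1))) , ?_⟩
    rw [Real.exp_log (by positivity), div_mul_eq_mul_div, div_lt_div_iff₀ (by positivity) two_pos]
    nlinarith
  obtain ⟨B, hB⟩ := (htop.eventually (eventually_gt_atTop (2 * c / m))).exists
  refine ⟨B - q, fun g hg v => ?_⟩
  by_contra! hv
  have key : ∀ u : S n, Ψ B * (max ⟪(v : E n), (u : E n)⟫ 0 - Real.exp q) ≤ Ψ (logEnvelope g u) := by
    intro u
    have h01 := max_inner_mem_Icc v u
    by_cases hcase : max ⟪(v : E n), (u : E n)⟫ 0 ≤ Real.exp q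
    · exact (mul_nonpos_of_nonneg_of_nonpos (hpos B).le (by linarith)).trans (hpos _).le
    · push Not at hcase
      have hin : Real.exp q < ⟪(u : E n), (v : E n)⟫ := by
        rw [real_inner_comm]
        exact (lt_max_iff.1 hcase).resolve_right (Real.exp_pos q).not_gt
      have hle : B ≤ logEnvelope g u := by
        rw [← Real.exp_le_exp]
        refine le_trans ?_ (exp_mul_inner_le g u v)
        calc Real.exp B = Real.exp (B - q) * Real.exp q := by rw [← Real.exp_add]; ring_nf
          _ ≤ _ := by gcongr
      calc _ ≤ Ψ B * 1 := by
            have := hpos B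
            gcongr
            linarith [h01.2, Real.exp_pos q]
        _ ≤ _ := by rw [mul_one]; exact hmono hle
  have h1 := integral_mono (μ := σ) (integrable_of_continuous
    (f := fun u : S n => Ψ B * (max ⟪(v : E n), (u : E n)⟫ 0 - Real.exp q)) (by fun_prop))
    (integrable_comp_continuousMap hc (logEnvelope g)) key
  rw [integral_const_mul, integral_sub (integrable_of_continuous (continuous_max_inner _))
    (integrable_const _), integral_const, smul_eq_mul, ← hA] at h1
  have h2 := hmσ v
  have h3 : Ψ B * (m / 2) ≤ c := by
    refine le_trans ?_ (h1.trans hg)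
    have := hpos B
    gcongr
    linarith
  rw [div_lt_iff₀ hm] at hB
  linarith

/-- Existence of a maximizer of `∫ g dμ` under the constraint `∫ Ψ (logEnvelope g) dσ ≤ c`. -/
lemma exists_maximizer {σ μ : Measure (S n)} [IsFiniteMeasure σ] [IsFiniteMeasure μ]
    (hσ : NotConcentrated σ) (hμ : NotConcentrated μ)
    {Ψ : ℝ → ℝ} (hc : Continuous Ψ) (hpos : ∀ t, 0 < Ψ t) (hmono : Monotone Ψ)
    (htop : Tendsto Ψ atTop atTop) :
    ∃ g : C(S n, ℝ), ∫ u, Ψ (logEnvelope g u) ∂σ ≤ ∫ _, Ψ 0 ∂σ ∧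
      ∀ g' : C(S n, ℝ), ∫ u, Ψ (logEnvelope g' u) ∂σ ≤ ∫ _, Ψ 0 ∂σ →
        ∫ v, g' v ∂μ ≤ ∫ v, g v ∂μ := by
  set c := ∫ _ : S n, Ψ 0 ∂σ
  obtain ⟨b, hb⟩ := exists_bound_of_integral_le hσ hc hpos hmono htop c
  obtain ⟨m, hm, hmμ⟩ := hμ.exists_lower_bound
  set a := b + 1 - (b + 1) * μ.real univ / m
  set J : C(S n, ℝ) → ℝ := fun g => ∫ u, Ψ (logEnvelope g u) ∂σ
  have hJ : Continuous J := by
    have h1 : Continuous fun g : C(S n, ℝ) =>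
        ∫ u, ((⟨Ψ, hc⟩ : C(ℝ, ℝ)).comp (logEnvelope g)) u ∂σ :=
      (continuous_integral σ).comp (ContinuousMap.continuous_postcomp _ |>.comp continuous_logEnvelope)
    exact h1
  set A : Set C(S n, ℝ) :=
    {g | (∀ v, g v ∈ Icc a b) ∧ LipschitzWith (Real.exp (b - a)).toNNReal g} ∩ {g | J g ≤ c}
  have hA : IsCompact A := (isCompact_lipschitz_Icc a b _).inter_right
    (isClosed_le hJ continuous_const)
  have himp : ∀ g, J g ≤ c → 0 ≤ ∫ v, g v ∂μ →
      convexify g ∈ A ∧ ∫ v, g v ∂μ ≤ ∫ v, convexify g v ∂μ := by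
    intro g hg h0
    have hab : ∀ u, logEnvelope g u ∈ Icc a b := fun u =>
      ⟨logEnvelope_lower_bound hm hmμ (hb g hg) h0 u, logEnvelope_le (hb g hg) u⟩
    refine ⟨⟨⟨convexify_mem_Icc hab, lipschitzWith_convexify hab⟩, ?_⟩,
      integral_mono (integrable_of_continuous g.continuous)
        (integrable_of_continuous (convexify g).continuous) (le_convexify g)⟩
    simpa only [J, mem_ofPred_eq, logEnvelope_convexify] using hg
  have hzero : J 0 ≤ c := integral_mono (integrable_comp_continuousMap hc _) (integrable_const _)
    fun u => hmono (logEnvelope_le (fun v => le_rfl) u)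
  have hI : Continuous fun g : C(S n, ℝ) => ∫ v, g v ∂μ := continuous_integral μ
  obtain ⟨g, hgA, hg⟩ := hA.exists_isMaxOn ⟨_, (himp 0 hzero (by simp)).1⟩ hI.continuousOn
  refine ⟨g, hgA.2, fun g' hg' => ?_⟩
  -- The lower bound needs a nonnegative objective. Candidates with a negative one are beaten by
  -- `0`, which is feasible by the choice of `c`.
  rcases le_total 0 (∫ v, g' v ∂μ) with h0 | h0
  · obtain ⟨h1, h2⟩ := himp g' hg' h0
    exact h2.trans (hg h1)
  · have h1 := himp 0 hzero (by simp)
    have h2 := hg h1.1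
    have h3 := h1.2
    simp only [ContinuousMap.zero_apply, integral_zero] at h3
    exact h0.trans (h3.trans h2)

end Bounds

/-! ### Almost everywhere differentiability and the normal direction -/

lemma differentiableAt_envelope_smul {g : C(S n, ℝ)} {x : E n} {t : ℝ} (ht : 0 < t)
    (hd : DifferentiableAt ℝ (envelope g) (t • x)) : DifferentiableAt ℝ (envelope g) x := by
  have h1 : DifferentiableAt ℝ (fun y => envelope g (t • y)) x :=
    DifferentiableAt.comp (g := envelope g) x hd (differentiableAt_id.const_smul t)
  have h2 : envelope g = fun y => t⁻¹ * envelope g (t • y) := by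
    ext y
    rw [envelope_smul g ht.le, inv_mul_cancel_left₀ ht.ne']
  rw [h2]
  exact h1.const_mul _

section Normal

variable [Nonempty (S n)]

/-- The direction of a nonzero vector, with an arbitrary value at the origin. -/
def direction (x : E n) : S n :=
  ⟨if x = 0 then (Classical.arbitrary (S n) : E n) else ‖x‖⁻¹ • x, by
    split_ifs with h
    · exact (Classical.arbitrary (S n)).2
    · simp [norm_smul, h]⟩

lemma measurable_direction : Measurable (direction : E n → S n) := by
  refine Measurable.subtype_mk ?_
  exact Measurable.ite (measurableSet_singleton 0) measurable_const (by fun_prop)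

lemma direction_smul {c : ℝ} (hc : 0 < c) (v : S n) : direction (c • (v : E n)) = v := by
  have hv : (v : E n) ≠ 0 := ne_zero_of_mem_unit_sphere v
  ext1
  simp [direction, hc.ne', hv, norm_smul, smul_smul, abs_of_pos hc]

/-- The direction of the gradient of the envelope. -/
def normalDir (g : C(S n, ℝ)) (u : S n) : S n := direction (gradient (envelope g) (u : E n))

lemma measurable_normalDir (g : C(S n, ℝ)) : Measurable (normalDir g) := by
  refine measurable_direction.comp ?_
  exact ((InnerProductSpace.toDual ℝ (E n)).symm.continuous.measurable.comp
    (measurable_fderiv ℝ (envelope g))).comp measurable_subtype_coe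

/-- The envelope minus a linear minorant touching it at `u` has a minimum there, so the gradient is
`c • v`. This serves both for maximizers in the envelope and for supporting hyperplanes of the polar
body. -/
lemma normalDir_eq {g : C(S n, ℝ)} {u v : S n} (hd : DifferentiableAt ℝ (envelope g) (u : E n))
    {c : ℝ} (hc : 0 < c) (hle : ∀ y, c * ⟪y, (v : E n)⟫ ≤ envelope g y)
    (heq : c * ⟪(u : E n), (v : E n)⟫ = envelope g u) : normalDir g u = v := by
  have h1 : HasFDerivAt (fun y => envelope g y - innerSL ℝ (c • (v : E n)) y)
      (fderiv ℝ (envelope g) (u : E n) - innerSL ℝ (c • (v : E n))) (u : E n) :=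
    hd.hasFDerivAt.sub (innerSL ℝ (c • (v : E n))).hasFDerivAt
  have hin : ∀ y, innerSL ℝ (c • (v : E n)) y = c * ⟪y, (v : E n)⟫ := by
    intro y
    rw [innerSL_apply_apply, real_inner_smul_left, real_inner_comm]
  have h2 : IsLocalMin (fun y => envelope g y - innerSL ℝ (c • (v : E n)) y) (u : E n) := by
    refine Eventually.of_forall fun y => ?_
    simp only [hin]
    linarith [hle y]
  have h3 := sub_eq_zero.1 (h2.hasFDerivAt_eq_zero h1)
  have h4 : gradient (envelope g) (u : E n) = c • (v : E n) := by
    rw [gradient, h3]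
    exact (InnerProductSpace.toDual ℝ (E n)).symm_apply_apply _
  rw [normalDir, h4, direction_smul hc]

lemma eq_normalDir_of_maximizer {g : C(S n, ℝ)} {u v : S n}
    (hd : DifferentiableAt ℝ (envelope g) (u : E n))
    (h : Real.exp (g v) * ⟪(u : E n), (v : E n)⟫ = Real.exp (logEnvelope g u)) :
    v = normalDir g u :=
  (normalDir_eq hd (Real.exp_pos _) (fun y => le_envelope g y v)
    (by rw [h, exp_logEnvelope])).symm

/-- Rademacher's theorem passes to the sphere because spherical measure is computed from the volume
of cones and differentiability is invariant under positive scaling. -/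
lemma ae_differentiableAt_envelope (g : C(S n, ℝ)) :
    ∀ᵐ u ∂sphericalMeasure n, DifferentiableAt ℝ (envelope g) ((u : S n) : E n) := by
  obtain ⟨C, hC⟩ := lipschitzWith_envelope g
  have hm : MeasurableSet {u : S n | ¬ DifferentiableAt ℝ (envelope g) (u : E n)} :=
    ((measurableSet_of_differentiableAt ℝ (envelope g)).preimage measurable_subtype_coe).compl
  have hnull : volume {x | ¬ DifferentiableAt ℝ (envelope g) x} = 0 :=
    ae_iff.1 (hC.ae_differentiableAt (μ := volume))
  rw [ae_iff, sphericalMeasure, Measure.toSphere_apply' _ hm]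
  refine mul_eq_zero_of_right _ (measure_mono_null ?_ hnull)
  rintro _ ⟨t, ht, _, ⟨u, hu, rfl⟩, rfl⟩
  exact fun h => hu (differentiableAt_envelope_smul ht.1 h)

end Normal

/-! ### First variation and the Euler–Lagrange equation -/

section Variation

variable [Nonempty (S n)]

/-- Danskin's formula at a point with a unique maximizer. -/
lemma hasDerivAt_logEnvelope {g k : C(S n, ℝ)} {u v : S n}
    (huniq : ∀ w : S n,
      Real.exp (g w) * ⟪(u : E n), (w : E n)⟫ = Real.exp (logEnvelope g u) → w = v) :
    HasDerivAt (fun t : ℝ => logEnvelope (g + t • k) u) (k v) 0 := by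
  have hv : Real.exp (g v) * ⟪(u : E n), (v : E n)⟫ = Real.exp (logEnvelope g u) := by
    obtain ⟨w, hw⟩ := exists_exp_mul_inner_eq g u
    rwa [← huniq w hw]
  rw [hasDerivAt_iff_isLittleO, Asymptotics.isLittleO_iff]
  intro ε hε
  -- Directions in `B` are not maximizers at `t = 0`. The times at which some direction in `B` is a
  -- maximizer form the projection of a closed set along the compact sphere, hence a closed set
  -- missing `0`.
  set B : Set (S n) := {w | ε ≤ |k w - k v|}
  have hBc : IsClosed B := isClosed_le continuous_const (by fun_prop)
  have hlog : Continuous fun t : ℝ => logEnvelope (g + t • k) u :=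
    (continuous_eval_const (F := C(S n, ℝ)) u).comp (continuous_logEnvelope.comp (by fun_prop))
  have hcl : IsClosed {p : ℝ × S n | p.2 ∈ B ∧
      Real.exp (g p.2 + p.1 * k p.2) * ⟪(u : E n), (p.2 : E n)⟫ =
        Real.exp (logEnvelope (g + p.1 • k) u)} :=
    (hBc.preimage continuous_snd).inter
      (isClosed_eq (by fun_prop) (Real.continuous_exp.comp (hlog.comp continuous_fst)))
  have hproj := isClosedMap_fst_of_compactSpace _ hcl
  have h0 : (0 : ℝ) ∉ Prod.fst '' {p : ℝ × S n | p.2 ∈ B ∧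
      Real.exp (g p.2 + p.1 * k p.2) * ⟪(u : E n), (p.2 : E n)⟫ =
        Real.exp (logEnvelope (g + p.1 • k) u)} := by
    rintro ⟨⟨t, w⟩, ⟨hw1, hw2⟩, rfl⟩
    simp only [zero_mul, add_zero, zero_smul] at hw2
    have := huniq w hw2
    simp only [B, mem_ofPred_eq, this, sub_self, abs_zero] at hw1
    exact hε.not_ge hw1
  filter_upwards [hproj.isOpen_compl.mem_nhds h0] with t ht
  obtain ⟨w, hw⟩ := exists_exp_mul_inner_eq (g + t • k) u
  have hwB : |k w - k v| < ε := by
    by_contra! hcon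
    exact ht ⟨(t, w), ⟨hcon, by simpa using hw⟩, rfl⟩
  -- The increment lies between `t * k v` and `t * k w`, by testing each envelope with a maximizer
  -- of the other.
  have hup := logEnvelope_le_add (g' := g) (d := t * k w) hw (by simp)
  have hlow := logEnvelope_le_add (g' := g + t • k) (d := -(t * k v)) hv (by simp)
  simp only [zero_smul, add_zero, sub_zero, smul_eq_mul, Real.norm_eq_abs]
  have h1 : t * (k w - k v) ≤ ε * |t| := by
    calc t * (k w - k v) ≤ |t * (k w - k v)| := le_abs_self _
      _ = |k w - k v| * |t| := by rw [abs_mul, mul_comm]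
      _ ≤ _ := by gcongr
  rw [abs_le]
  have h2 : 0 ≤ ε * |t| := by positivity
  constructor <;> linarith

lemma abs_logEnvelope_le (g : C(S n, ℝ)) (u : S n) : |logEnvelope g u| ≤ ‖g‖ := by
  rw [abs_le]
  exact ⟨(abs_le.1 (g.norm_coe_le_norm u)).1.trans (le_logEnvelope g u),
    logEnvelope_le (fun v => (le_abs_self _).trans (g.norm_coe_le_norm v)) u⟩

lemma hasDerivAt_integral_logEnvelope {Ψ ψ : ℝ → ℝ} (hd : ∀ t, HasDerivAt Ψ (ψ t) t)
    (hψ : Continuous ψ) (g k : C(S n, ℝ)) :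
    HasDerivAt (fun t : ℝ => ∫ u, Ψ (logEnvelope (g + t • k) u) ∂sphericalMeasure n)
      (∫ u, ψ (logEnvelope g u) * k (normalDir g u) ∂sphericalMeasure n) 0 := by
  have : IsFiniteMeasure (sphericalMeasure n) := by unfold sphericalMeasure; infer_instance
  have hΨ : Continuous Ψ := continuous_iff_continuousAt.2 fun t => (hd t).continuousAt
  obtain ⟨b, hb⟩ : ∃ b, b = ‖g‖ + ‖k‖ := ⟨_, rfl⟩
  have hb0 : 0 ≤ b := hb ▸ by positivity
  obtain ⟨M, hM⟩ := isCompact_Icc.exists_bound_of_continuousOn (s := Icc (-b) b) hψ.continuousOn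
  have hlip : ∀ x ∈ Icc (-b) b, ∀ y ∈ Icc (-b) b, |Ψ x - Ψ y| ≤ M * |x - y| := fun x hx y hy =>
    (convex_Icc (-b) b).norm_image_sub_le_of_norm_hasDerivWithin_le
      (fun z _ => (hd z).hasDerivWithinAt) hM hy hx
  refine (hasDerivAt_integral_of_dominated_loc_of_lip (s := ball 0 1)
    (bound := fun _ => M * ‖k‖) (ball_mem_nhds 0 one_pos)
    (Eventually.of_forall fun t => (integrable_comp_continuousMap hΨ _).aestronglyMeasurable)
    (integrable_comp_continuousMap hΨ _)
    (((hψ.comp (logEnvelope g).continuous).measurable.mul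
      (k.continuous.measurable.comp (measurable_normalDir g))).aestronglyMeasurable)
    (Eventually.of_forall fun u => ?_) (integrable_const _) ?_).2
  · have hmem : ∀ t ∈ ball (0 : ℝ) 1, logEnvelope (g + t • k) u ∈ Icc (-b) b := by
      intro t ht
      rw [mem_ball_zero_iff] at ht
      refine abs_le.1 ((abs_logEnvelope_le _ u).trans ((norm_add_le _ _).trans ?_))
      rw [norm_smul, hb]
      gcongr
      exact mul_le_of_le_one_left (norm_nonneg _) ht.le
    have hM0 : 0 ≤ M := (norm_nonneg _).trans (hM 0 ⟨by linarith, hb0⟩)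
    refine LipschitzOnWith.of_dist_le_mul fun t ht s hs => ?_
    rw [Real.dist_eq, Real.coe_nnabs, abs_of_nonneg (mul_nonneg hM0 (norm_nonneg _)), mul_assoc]
    refine (hlip _ (hmem t ht) _ (hmem s hs)).trans ?_
    gcongr
    refine (dist_logEnvelope_le _ _ u).trans_eq ?_
    rw [dist_add_left, dist_eq_norm, ← sub_smul, norm_smul, mul_comm, Real.dist_eq, Real.norm_eq_abs]
  · filter_upwards [ae_differentiableAt_envelope g] with u hu
    have h1 := hasDerivAt_logEnvelope (k := k) (v := normalDir g u)
      fun w hw => eq_normalDir_of_maximizer hu hw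
    have h2 : HasDerivAt Ψ (ψ (logEnvelope g u)) (logEnvelope (g + (0 : ℝ) • k) u) := by
      simpa using hd (logEnvelope g u)
    exact h2.comp 0 h1

/-- The Euler–Lagrange inequality at a constrained maximizer. -/
lemma integral_variation_nonneg {Ψ ψ : ℝ → ℝ} (hd : ∀ t, HasDerivAt Ψ (ψ t) t)
    (hψ : Continuous ψ) {μ : Measure (S n)} [IsFiniteMeasure μ] {g : C(S n, ℝ)} {c : ℝ}
    (hg : ∫ u, Ψ (logEnvelope g u) ∂sphericalMeasure n ≤ c)
    (hmax : ∀ g' : C(S n, ℝ), ∫ u, Ψ (logEnvelope g' u) ∂sphericalMeasure n ≤ c →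
        ∫ v, g' v ∂μ ≤ ∫ v, g v ∂μ) (k : C(S n, ℝ)) (hk : 0 < ∫ v, k v ∂μ) :
    0 ≤ ∫ u, ψ (logEnvelope g u) * k (normalDir g u) ∂sphericalMeasure n := by
  -- Otherwise a small step along `k` would keep the constraint and increase the objective.
  by_contra! hneg
  have h1 := hasDerivAt_integral_logEnvelope hd hψ g k
  have h2 := ((hasDerivWithinAt_iff_tendsto_slope' self_notMem_Ioi).1
    (h1.hasDerivWithinAt (s := Ioi 0))).eventually_lt_const hneg
  obtain ⟨t, ht, ht0⟩ := (h2.and self_mem_nhdsWithin).exists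
  have ht0 : 0 < t := ht0
  rw [slope_def_field, sub_zero, div_neg_iff] at ht
  have ht' := (ht.resolve_left fun h => h.2.not_gt ht0).1
  simp only [zero_smul, add_zero] at ht'
  have h3 := hmax (g + t • k) (by linarith)
  have h4 : ∫ v, (g + t • k) v ∂μ = ∫ v, g v ∂μ + t * ∫ v, k v ∂μ := by
    rw [← integral_const_mul, ← integral_add (integrable_of_continuous g.continuous)
      (integrable_of_continuous (by fun_prop))]
    rfl
  nlinarith [mul_pos ht0 hk]

/-- Let `ν` be the pushforward of the weighted spherical measure under `normalDir g`. The
variational inequality shows that the functional `∫ k dν` vanishes on the kernel of `∫ k dμ`, so `ν`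
is a multiple of `μ`; the constant drops out on normalizing. -/
lemma exists_normalized_eq {Ψ ψ : ℝ → ℝ} (hd : ∀ t, HasDerivAt Ψ (ψ t) t)
    (hψ : Continuous ψ) (hψpos : ∀ t, 0 < ψ t) (hpos : ∀ t, 0 < Ψ t)
    (htop : Tendsto Ψ atTop atTop) {μ : Measure (S n)} [IsFiniteMeasure μ] (hμ0 : μ ≠ 0)
    (hμ : NotConcentrated μ) :
    ∃ g : C(S n, ℝ), ∀ η : Set (S n), MeasurableSet η →
      μ η / μ univ =
        (∫⁻ u in normalDir g ⁻¹' η, ENNReal.ofReal (ψ (logEnvelope g u)) ∂sphericalMeasure n) /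
          ∫⁻ u, ENNReal.ofReal (ψ (logEnvelope g u)) ∂sphericalMeasure n := by
  have : IsFiniteMeasure (sphericalMeasure n) := by unfold sphericalMeasure; infer_instance
  have hΨ : Continuous Ψ := continuous_iff_continuousAt.2 fun t => (hd t).continuousAt
  have hmono : Monotone Ψ := monotone_of_hasDerivAt_nonneg hd fun t => (hψpos t).le
  obtain ⟨g, hg, hmax⟩ := exists_maximizer notConcentrated_sphericalMeasure hμ hΨ hpos hmono htop
  have hvar := integral_variation_nonneg hd hψ hg hmax
  refine ⟨g, ?_⟩
  have hint : Integrable (fun u => ψ (logEnvelope g u)) (sphericalMeasure n) :=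
    integrable_comp_continuousMap hψ _
  set τ := (sphericalMeasure n).withDensity fun u => ENNReal.ofReal (ψ (logEnvelope g u)) with hτ
  have : IsFiniteMeasure τ := isFiniteMeasure_withDensity_ofReal hint.2
  have hN := measurable_normalDir g
  set ν := τ.map (normalDir g) with hν
  have : IsFiniteMeasure ν := by rw [hν]; infer_instance
  have hνint : ∀ k : C(S n, ℝ), ∫ v, k v ∂ν =
      ∫ u, ψ (logEnvelope g u) * k (normalDir g u) ∂sphericalMeasure n := by
    intro k
    have hm : Measurable fun u => ENNReal.ofReal (ψ (logEnvelope g u)) :=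
      (hψ.comp (logEnvelope g).continuous).measurable.ennreal_ofReal
    rw [hν, integral_map hN.aemeasurable k.continuous.aestronglyMeasurable, hτ,
      integral_withDensity_eq_integral_toReal_smul hm
        (Eventually.of_forall fun _ => ENNReal.ofReal_lt_top)]
    refine integral_congr_ae (Eventually.of_forall fun u => ?_)
    simp only [ENNReal.toReal_ofReal (hψpos _).le, smul_eq_mul]
  have hμpos : 0 < μ.real univ := by
    rw [measureReal_def]
    exact ENNReal.toReal_pos (by simpa using hμ0) (measure_ne_top _ _)
  have hconst : ∀ (ρ : Measure (S n)) [IsFiniteMeasure ρ] (k : C(S n, ℝ)) (a : ℝ),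
      ∫ v, (k + ContinuousMap.const (S n) a) v ∂ρ = ∫ v, k v ∂ρ + ρ.real univ * a := by
    intro ρ _ k a
    simp only [ContinuousMap.add_apply, ContinuousMap.const_apply]
    rw [integral_add (integrable_of_continuous k.continuous) (integrable_const _), integral_const,
      smul_eq_mul]
  have hnn : ∀ k : C(S n, ℝ), ∫ v, k v ∂μ = 0 → 0 ≤ ∫ v, k v ∂ν := by
    intro k hk
    refine le_of_forall_pos_lt_add fun ε hε => ?_
    have hA : 0 ≤ ν.real univ := measureReal_nonneg
    -- Adding the constant `δ` makes the `μ`-integral strictly positive and changes the `ν`-integral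
    -- by less than `ε`.
    set δ := ε / (ν.real univ + 1)
    have hδ : 0 < δ := by positivity
    have h1 := hvar (k + ContinuousMap.const _ δ) (by rw [hconst, hk, zero_add]; positivity)
    rw [← hνint, hconst] at h1
    have h2 : ν.real univ * δ < ε := by
      rw [mul_div_assoc', div_lt_iff₀ (by positivity)]
      nlinarith
    linarith
  have hzero : ∀ k : C(S n, ℝ), ∫ v, k v ∂μ = 0 → ∫ v, k v ∂ν = 0 := by
    intro k hk
    refine le_antisymm ?_ (hnn k hk)
    have h := hnn (-k) (by simp only [ContinuousMap.neg_apply, integral_neg, hk, neg_zero])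
    simp only [ContinuousMap.neg_apply, integral_neg] at h
    linarith
  have heq : ν = (ENNReal.ofReal (ν.real univ / μ.real univ)) • μ := by
    have : IsFiniteMeasure (ENNReal.ofReal (ν.real univ / μ.real univ) • μ) :=
      μ.smul_finite ENNReal.ofReal_ne_top
    refine ext_of_forall_integral_eq_of_IsFiniteMeasure fun f => ?_
    -- Subtracting the `μ`-mean of `f` puts it in the kernel.
    have h := hzero (f.toContinuousMap + ContinuousMap.const _ (-(∫ v, f v ∂μ) / μ.real univ)) (by
      rw [hconst]
      field_simp
      exact add_neg_cancel _)
    rw [hconst] at h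
    rw [integral_smul_measure, ENNReal.toReal_ofReal (div_nonneg measureReal_nonneg hμpos.le),
      smul_eq_mul]
    have h' : ∫ v, f v ∂ν + ν.real univ * (-(∫ v, f v ∂μ) / μ.real univ) = 0 := h
    linear_combination h'
  have hτuniv : τ univ = ∫⁻ u, ENNReal.ofReal (ψ (logEnvelope g u)) ∂sphericalMeasure n := by
    rw [hτ, withDensity_apply _ MeasurableSet.univ, Measure.restrict_univ]
  have hνuniv : ν univ = τ univ := by
    rw [hν, Measure.map_apply hN MeasurableSet.univ, preimage_univ]
  have hσpos : 0 < ν.real univ := by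
    have h1 : 0 < ∫ u, ψ (logEnvelope g u) ∂sphericalMeasure n := by
      have : (sphericalMeasure n).IsOpenPosMeasure := by unfold sphericalMeasure; infer_instance
      exact (hψ.comp (logEnvelope g).continuous).integral_pos_of_hasCompactSupport_nonneg_nonzero
        (HasCompactSupport.of_compactSpace _) (fun u => (hψpos _).le)
        (x := Classical.arbitrary (S n)) (hψpos _).ne'
    have h2 := hνint 1
    simp only [ContinuousMap.one_apply, mul_one, integral_const, smul_eq_mul] at h2
    rwa [h2]
  intro η hη
  rw [← hτuniv, ← hνuniv, ← withDensity_apply _ (hN hη), ← hτ, ← Measure.map_apply hN hη, ← hν, heq,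
    Measure.smul_apply, Measure.smul_apply, smul_eq_mul, smul_eq_mul,
    ENNReal.mul_div_mul_left _ _ (by simpa using div_pos hσpos hμpos) ENNReal.ofReal_ne_top]

end Variation

/-! ### Support and radial functions of convex bodies -/

section ConvexBodies

variable {K : ConvexBody (E n)}

lemma inner_le_supportFn {x : E n} (hx : x ∈ (K : Set (E n))) (v : S n) :
    ⟪x, (v : E n)⟫ ≤ supportFn K v := by
  obtain ⟨R, hR⟩ := K.isCompact.isBounded.exists_norm_le
  refine le_csSup ⟨R, ?_⟩ ⟨x, hx, rfl⟩
  rintro _ ⟨y, hy, rfl⟩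
  exact (inner_sphere_le y v).trans (hR y hy)

lemma supportFn_le {v : S n} {a : ℝ} (h : ∀ x ∈ (K : Set (E n)), ⟪x, (v : E n)⟫ ≤ a) :
    supportFn K v ≤ a := by
  obtain ⟨x, hx⟩ := K.nonempty
  refine csSup_le ⟨_, x, hx, rfl⟩ ?_
  rintro _ ⟨y, hy, rfl⟩
  exact h y hy

lemma exists_closedBall_subset (h0 : (0 : E n) ∈ interior (K : Set (E n))) :
    ∃ ε > 0, closedBall (0 : E n) ε ⊆ K :=
  nhds_basis_closedBall.mem_iff.1 (mem_interior_iff_mem_nhds.1 h0)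

lemma le_supportFn {ε : ℝ} (hε : 0 < ε) (h : closedBall (0 : E n) ε ⊆ K) (v : S n) :
    ε ≤ supportFn K v := by
  have := inner_le_supportFn (K := K) (x := ε • (v : E n))
    (h (by simp [norm_smul, abs_of_pos hε])) v
  rwa [real_inner_smul_left, inner_self_sphere, mul_one] at this

lemma bddAbove_radial (K : ConvexBody (E n)) (u : S n) :
    BddAbove {r : ℝ | r • (u : E n) ∈ (K : Set (E n))} := by
  obtain ⟨R, hR⟩ := K.isCompact.isBounded.exists_norm_le
  refine ⟨R, fun r hr => ?_⟩
  have := hR _ hr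
  rw [norm_smul, norm_sphere, mul_one] at this
  exact (le_abs_self r).trans this

lemma le_radialFn {ε : ℝ} (hε : 0 < ε) (h : closedBall (0 : E n) ε ⊆ K) (u : S n) :
    ε ≤ radialFn K u :=
  le_csSup (bddAbove_radial K u) (h (by simp [norm_smul, abs_of_pos hε]))

lemma radialFn_smul_mem {ε : ℝ} (hε : 0 < ε) (h : closedBall (0 : E n) ε ⊆ K) (u : S n) :
    radialFn K u • (u : E n) ∈ (K : Set (E n)) := by
  have hc : IsClosed {r : ℝ | r • (u : E n) ∈ (K : Set (E n))} :=
    K.isCompact.isClosed.preimage (by fun_prop)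
  exact hc.csSup_mem ⟨ε, h (by simp [norm_smul, abs_of_pos hε])⟩ (bddAbove_radial K u)

lemma radialFn_smul_mem_frontier {ε : ℝ} (hε : 0 < ε) (h : closedBall (0 : E n) ε ⊆ K) (u : S n) :
    radialFn K u • (u : E n) ∈ frontier (K : Set (E n)) := by
  refine ⟨subset_closure (radialFn_smul_mem hε h u), fun hint => ?_⟩
  have hc : Continuous fun r : ℝ => r • (u : E n) := by fun_prop
  have hnhds : ∀ᶠ r in 𝓝 (radialFn K u), r • (u : E n) ∈ (K : Set (E n)) :=
    hc.continuousAt.eventually (mem_interior_iff_mem_nhds.1 hint)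
  obtain ⟨r, hr, hrK⟩ := (frequently_gt_nhds (radialFn K u)).and_eventually hnhds |>.exists
  exact (le_csSup (bddAbove_radial K u) hrK).not_gt hr

lemma exists_mem_supportingHyperplane (h0 : (0 : E n) ∈ interior (K : Set (E n))) {x : E n}
    (hx : x ∈ frontier (K : Set (E n))) : ∃ v, x ∈ supportingHyperplane K v := by
  obtain ⟨f, hf⟩ := geometric_hahn_banach_open_point K.convex.interior isOpen_interior hx.2
  have hle : ∀ y ∈ (K : Set (E n)), f y ≤ f x := by
    intro y hy
    -- Hahn–Banach separates `x` only from the interior; the weak inequality extends to `K` because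
    -- the interior is dense in it.
    have h1 : y ∈ closure (interior (K : Set (E n))) := by
      rw [K.convex.closure_interior_eq_closure_of_nonempty_interior ⟨0, h0⟩]
      exact subset_closure hy
    exact closure_minimal (fun z hz => (hf z hz).le)
      (isClosed_le f.continuous continuous_const) h1
  set w := (InnerProductSpace.toDual ℝ (E n)).symm f with hw
  have hfw : ∀ y, ⟪y, w⟫ = f y := fun y => by
    rw [real_inner_comm, hw, InnerProductSpace.toDual_symm_apply]
  have hw0 : w ≠ 0 := by
    intro h
    have := hf 0 h0
    rw [← hfw, ← hfw, h, inner_zero_right, inner_zero_right] at this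
    exact lt_irrefl _ this
  have hin : ∀ y, ⟪y, ‖w‖⁻¹ • w⟫ = ‖w‖⁻¹ * f y := fun y => by rw [real_inner_smul_right, hfw]
  refine ⟨⟨‖w‖⁻¹ • w, by simp [norm_smul, hw0]⟩, ?_⟩
  refine le_antisymm (inner_le_supportFn (K.isCompact.isClosed.frontier_subset hx) _)
    (supportFn_le fun y hy => ?_)
  simp only [hin]
  gcongr
  exact hle y hy

end ConvexBodies

/-! ### The polar body and its reverse radial Gauss image -/

section UnitBody

variable [Nonempty (S n)]

lemma mul_norm_le_envelope (g : C(S n, ℝ)) (x : E n) : Real.exp (-‖g‖) * ‖x‖ ≤ envelope g x := by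
  rcases eq_or_ne x 0 with rfl | hx
  · have := envelope_smul g le_rfl (0 : E n)
    rw [zero_smul, zero_mul] at this
    simp [this]
  · let v : S n := ⟨‖x‖⁻¹ • x, by simp [norm_smul, hx]⟩
    have hv : ⟪x, (v : E n)⟫ = ‖x‖ := by
      simp only [v]
      rw [real_inner_smul_right, real_inner_self_eq_norm_sq]
      field_simp
    have := le_envelope g x v
    rw [hv] at this
    refine le_trans ?_ this
    gcongr
    exact (abs_le.1 (g.norm_coe_le_norm v)).1

/-- The convex body whose gauge function is the envelope of `g`. -/
def unitBody (g : C(S n, ℝ)) : ConvexBody (E n) where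
  carrier := {x | envelope g x ≤ 1}
  convex' := by
    intro x hx y hy a b ha hb hab
    refine (envelope_add_le g _ _).trans ?_
    rw [envelope_smul g ha, envelope_smul g hb]
    have hx : envelope g x ≤ 1 := hx
    have hy : envelope g y ≤ 1 := hy
    nlinarith
  isCompact' := by
    obtain ⟨C, hC⟩ := lipschitzWith_envelope g
    refine Metric.isCompact_of_isClosed_isBounded (isClosed_le hC.continuous continuous_const) ?_
    refine isBounded_iff_forall_norm_le.2 ⟨Real.exp ‖g‖, fun x hx => ?_⟩
    have := (mul_norm_le_envelope g x).trans hx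
    rwa [Real.exp_neg, inv_mul_le_iff₀ (Real.exp_pos _), mul_one] at this
  nonempty' := ⟨0, by
    have := envelope_smul g le_rfl (0 : E n)
    rw [zero_smul, zero_mul] at this
    simp [this]⟩

lemma mem_unitBody {g : C(S n, ℝ)} {x : E n} :
    x ∈ (unitBody g : Set (E n)) ↔ envelope g x ≤ 1 := Iff.rfl

lemma zero_mem_interior_unitBody (g : C(S n, ℝ)) :
    (0 : E n) ∈ interior (unitBody g : Set (E n)) := by
  obtain ⟨C, hC⟩ := lipschitzWith_envelope g
  rw [mem_interior_iff_mem_nhds]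
  have h := hC.continuous.continuousAt (x := (0 : E n))
  have h0 := envelope_smul g le_rfl (0 : E n)
  rw [zero_smul, zero_mul] at h0
  filter_upwards [h.eventually_lt_const (h0.trans_lt one_pos)] with x hx using hx.le

lemma envelope_exp_neg_smul (g : C(S n, ℝ)) (u : S n) :
    envelope g (Real.exp (-logEnvelope g u) • (u : E n)) = 1 := by
  rw [envelope_smul g (Real.exp_pos _).le, ← exp_logEnvelope, ← Real.exp_add, neg_add_cancel,
    Real.exp_zero]

lemma radialFn_unitBody (g : C(S n, ℝ)) (u : S n) :
    radialFn (unitBody g) u = Real.exp (-logEnvelope g u) := by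
  refine IsGreatest.csSup_eq ⟨mem_unitBody.2 (envelope_exp_neg_smul g u).le, fun r hr => ?_⟩
  rcases le_total r 0 with h | h
  · exact h.trans (Real.exp_pos _).le
  · have hr : envelope g (r • (u : E n)) ≤ 1 := hr
    rw [envelope_smul g h, ← exp_logEnvelope] at hr
    rwa [Real.exp_neg, ← one_div, le_div_iff₀ (Real.exp_pos _)]

/-- The gauge of the body is the envelope, so a supporting hyperplane with normal `v` gives a linear
minorant of the envelope with factor `(supportFn (unitBody g) v)⁻¹`, touching it along the ray
through `x`. -/
lemma normalDir_eq_of_mem_supportingHyperplane {g : C(S n, ℝ)} {u v : S n} {x : E n}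
    (hd : DifferentiableAt ℝ (envelope g) (u : E n)) (hx : x ∈ frontier (unitBody g : Set (E n)))
    (hxv : x ∈ supportingHyperplane (unitBody g) v) (hu : (u : E n) = ‖x‖⁻¹ • x) :
    normalDir g u = v := by
  have h0 := zero_mem_interior_unitBody g
  obtain ⟨ε, hε, hball⟩ := exists_closedBall_subset h0
  have hx0 : x ≠ 0 := fun h => hx.2 (h ▸ h0)
  have hxn : 0 < ‖x‖ := norm_pos_iff.2 hx0
  have hxK : envelope g x ≤ 1 := (unitBody g).isCompact.isClosed.frontier_subset hx
  have hsupp : 0 < supportFn (unitBody g) v := hε.trans_le (le_supportFn hε hball v)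
  have hxv : ⟪x, (v : E n)⟫ = supportFn (unitBody g) v := hxv
  have hle : ∀ y, (supportFn (unitBody g) v)⁻¹ * ⟪y, (v : E n)⟫ ≤ envelope g y := by
    intro y
    rcases eq_or_ne y 0 with rfl | hy
    · simpa using mul_norm_le_envelope g (0 : E n)
    · have hpos := envelope_pos_of_ne_zero g hy
      have := inner_le_supportFn (K := unitBody g) (x := (envelope g y)⁻¹ • y)
        (mem_unitBody.2 (by rw [envelope_smul g (inv_pos.2 hpos).le, inv_mul_cancel₀ hpos.ne'])) v
      rw [real_inner_smul_left, inv_mul_le_iff₀ hpos] at this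
      rwa [inv_mul_le_iff₀ hsupp, mul_comm]
  refine normalDir_eq hd (inv_pos.2 hsupp) hle (le_antisymm (hle _) ?_)
  rw [hu, envelope_smul g (inv_pos.2 hxn).le, real_inner_smul_left, hxv, mul_left_comm,
    inv_mul_cancel₀ hsupp.ne']
  gcongr

lemma mem_reverseRadialGaussImage_unitBody {g : C(S n, ℝ)} {u : S n}
    (hd : DifferentiableAt ℝ (envelope g) (u : E n)) (η : Set (S n)) :
    u ∈ reverseRadialGaussImage (unitBody g) η ↔ normalDir g u ∈ η := by
  constructor
  · rintro ⟨x, hx, ⟨v, hv, hxv⟩, hu⟩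
    rwa [normalDir_eq_of_mem_supportingHyperplane hd hx hxv hu]
  · intro h
    obtain ⟨ε, hε, hball⟩ := exists_closedBall_subset (zero_mem_interior_unitBody g)
    have hfr := radialFn_smul_mem_frontier hε hball u
    have hpos : 0 < radialFn (unitBody g) u := hε.trans_le (le_radialFn hε hball u)
    have hu : (u : E n) = ‖radialFn (unitBody g) u • (u : E n)‖⁻¹ •
        radialFn (unitBody g) u • (u : E n) := by
      rw [norm_smul, norm_sphere, mul_one, Real.norm_of_nonneg hpos.le, smul_smul,
        inv_mul_cancel₀ hpos.ne', one_smul]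
    obtain ⟨v, hv⟩ := exists_mem_supportingHyperplane (zero_mem_interior_unitBody g) hfr
    refine ⟨_, hfr, ⟨_, h, ?_⟩, hu⟩
    rwa [normalDir_eq_of_mem_supportingHyperplane hd hfr hv hu]

/-- This replaces a set of unclear measurability, in the integral, by a preimage under a measurable
map. -/
lemma reverseRadialGaussImage_unitBody_ae_eq (g : C(S n, ℝ)) (η : Set (S n)) :
    reverseRadialGaussImage (unitBody g) η =ᵐ[sphericalMeasure n] normalDir g ⁻¹' η := by
  filter_upwards [ae_differentiableAt_envelope g] with u hu
  exact propext (mem_reverseRadialGaussImage_unitBody hu η)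

end UnitBody

/-! ### Consequences of the conditions on the two functions -/

section Conditions

variable {φ ϕ : ℝ → ℝ}

lemma Conditions.pos_of_pos (h : Conditions φ ϕ) {t : ℝ} (ht : 0 < t) : 0 < φ t := by
  rw [h.eq_neg_deriv_mul t ht]
  exact mul_pos (neg_pos.2 (h.deriv_neg t ht)) ht

/-- In the logarithmic variable the factor `t` in A3 is the chain-rule factor. -/
lemma Conditions.hasDerivAt_comp_exp (h : Conditions φ ϕ) (s : ℝ) :
    HasDerivAt (fun s => ϕ (Real.exp (-s))) (φ (Real.exp (-s))) s := by
  have h1 : HasDerivAt (fun s => Real.exp (-s)) (Real.exp (-s) * -1) s :=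
    (hasDerivAt_neg s).exp
  have h2 := (h.differentiableAt _ (Real.exp_pos (-s))).hasDerivAt.comp s h1
  have h3 : φ (Real.exp (-s)) = deriv ϕ (Real.exp (-s)) * (Real.exp (-s) * -1) := by
    rw [h.eq_neg_deriv_mul _ (Real.exp_pos _)]
    ring
  rw [h3]
  exact h2

lemma Conditions.continuous_comp_exp (h : Conditions φ ϕ) :
    Continuous fun s => φ (Real.exp (-s)) :=
  h.continuousOn.comp_continuous (by fun_prop) fun s => Real.exp_pos _

lemma Conditions.tendsto_comp_exp (h : Conditions φ ϕ) :
    Tendsto (fun s => ϕ (Real.exp (-s))) atTop atTop := by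
  refine h.tendsto_zero.comp (tendsto_nhdsWithin_iff.2 ⟨?_, Eventually.of_forall fun s => ?_⟩)
  · exact Real.tendsto_exp_neg_atTop_nhds_zero
  · exact Real.exp_pos _

lemma Conditions.exists_lower_bound (h : Conditions φ ϕ) {a b : ℝ} (ha : 0 < a) :
    ∃ δ > 0, ∀ t ∈ Icc a b, δ ≤ φ t := by
  rcases (Icc a b).eq_empty_or_nonempty with he | hne
  · exact ⟨1, one_pos, by simp [he]⟩
  · obtain ⟨t, ht, hmin⟩ := isCompact_Icc.exists_isMinOn hne
      (h.continuousOn.mono fun t ht => ha.trans_le ht.1)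
    exact ⟨φ t, h.pos_of_pos (ha.trans_le ht.1), fun s hs => hmin hs⟩

end Conditions

/-! ### Necessity of non-concentration, and the equivalence -/

/-- If `K` lies between balls of radii `ε` and `R`, an outer normal `v` at the boundary point in
direction `u` satisfies `⟪u, v⟫ ≥ ε / R`. Hence `⟪ξ, v⟫ > 0` for all `u` within distance `ε / R` of
`ξ`, and `φ(ρ)` is bounded below by a positive constant. -/
lemma dualCurvature_openHemisphere_pos {φ ϕ : ℝ → ℝ} (hφ : Conditions φ ϕ) {K : ConvexBody (E n)}
    (h0 : (0 : E n) ∈ interior (K : Set (E n))) (ξ : S n) :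
    0 < dualCurvature φ K {v : S n | 0 < ⟪(ξ : E n), (v : E n)⟫} := by
  obtain ⟨ε, hε, hball⟩ := exists_closedBall_subset h0
  obtain ⟨R, hR0, hR⟩ := K.isCompact.isBounded.exists_pos_norm_le
  have hρpos : ∀ u, 0 < radialFn K u := fun u => hε.trans_le (le_radialFn hε hball u)
  have hρ : ∀ u, radialFn K u ∈ Icc ε R := by
    refine fun u => ⟨le_radialFn hε hball u, ?_⟩
    have := hR _ (radialFn_smul_mem hε hball u)
    rwa [norm_smul, norm_sphere, mul_one, Real.norm_of_nonneg (hρpos u).le] at this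
  have hsub : ball ξ (ε / R) ⊆
      reverseRadialGaussImage K {v : S n | 0 < ⟪(ξ : E n), (v : E n)⟫} := by
    intro u hu
    have hfr := radialFn_smul_mem_frontier hε hball u
    obtain ⟨v, hv⟩ := exists_mem_supportingHyperplane h0 hfr
    refine ⟨_, hfr, ⟨v, ?_, hv⟩, ?_⟩
    · have h1 := le_supportFn hε hball v
      rw [← show _ = _ from hv, real_inner_smul_left] at h1
      have hin : 0 < ⟪(u : E n), (v : E n)⟫ :=
        pos_of_mul_pos_right (hε.trans_le h1) (hρpos u).le
      have h2 : ε / R ≤ ⟪(u : E n), (v : E n)⟫ := by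
        rw [div_le_iff₀ hR0, mul_comm]
        exact h1.trans (mul_le_mul_of_nonneg_right (hρ u).2 hin.le)
      have h3 := inner_sphere_le ((u : E n) - (ξ : E n)) v
      rw [inner_sub_left] at h3
      rw [mem_ball, Subtype.dist_eq, dist_eq_norm] at hu
      simp only [mem_ofPred_eq]
      linarith
    · rw [norm_smul, norm_sphere, mul_one, Real.norm_of_nonneg (hρpos u).le, smul_smul,
        inv_mul_cancel₀ (hρpos u).ne', one_smul]
  obtain ⟨δ, hδ, hδφ⟩ := hφ.exists_lower_bound (b := R) hε
  have : (sphericalMeasure n).IsOpenPosMeasure := by unfold sphericalMeasure; infer_instance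
  refine ENNReal.mul_pos (by simp) (ne_of_gt ?_)
  calc (0 : ℝ≥0∞) < ENNReal.ofReal δ * sphericalMeasure n (ball ξ (ε / R)) :=
        ENNReal.mul_pos (by simpa using hδ)
          (isOpen_ball.measure_ne_zero _ ⟨ξ, mem_ball_self (by positivity)⟩)
    _ = ∫⁻ _ in ball ξ (ε / R), ENNReal.ofReal δ ∂sphericalMeasure n := by
        rw [setLIntegral_const]
    _ ≤ ∫⁻ u in ball ξ (ε / R), ENNReal.ofReal (φ (radialFn K u)) ∂sphericalMeasure n :=
        lintegral_mono fun u => ENNReal.ofReal_le_ofReal (hδφ _ (hρ u))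
    _ ≤ _ := lintegral_mono_set hsub

end DualOrlicz

end

theorem theorem5p1 (n : ℕ) (φ ϕ : ℝ → ℝ) (hφ : DualOrlicz.Conditions φ ϕ)
    (μ : Measure (DualOrlicz.S n)) [IsFiniteMeasure μ] (hμ : μ ≠ 0) :
    DualOrlicz.NotConcentrated μ ↔
      ∃ K : ConvexBody (DualOrlicz.E n), (0 : DualOrlicz.E n) ∈ interior (K : Set (DualOrlicz.E n)) ∧
        ∀ η : Set (DualOrlicz.S n), MeasurableSet η →
          μ η / μ univ = DualOrlicz.dualCurvature φ K η / DualOrlicz.dualQuermass φ K := by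
  have hne : Nonempty (DualOrlicz.S n) := by
    by_contra h
    rw [not_nonempty_iff] at h
    exact hμ μ.eq_zero_of_isEmpty
  -- Needed to cancel the factor `n⁻¹`, which is `⊤` for `n = 0`.
  have hn : n ≠ 0 := by
    rintro rfl
    obtain ⟨u⟩ := hne
    exact ne_zero_of_mem_unit_sphere u (Subsingleton.elim _ _)
  have hμuniv : μ univ ≠ 0 := by simpa using hμ
  constructor
  · intro h
    obtain ⟨g, hg⟩ := DualOrlicz.exists_normalized_eq hφ.hasDerivAt_comp_exp
      hφ.continuous_comp_exp (fun t => hφ.pos_of_pos (Real.exp_pos _))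
      (fun t => hφ.pos _ (Real.exp_pos _)) hφ.tendsto_comp_exp hμ h
    refine ⟨DualOrlicz.unitBody g, DualOrlicz.zero_mem_interior_unitBody g, fun η hη => ?_⟩
    rw [hg η hη, DualOrlicz.dualCurvature, DualOrlicz.dualQuermass,
      Measure.restrict_congr_set (DualOrlicz.reverseRadialGaussImage_unitBody_ae_eq g η),
      ENNReal.mul_div_mul_left _ _ (by simp) (by simpa using hn)]
    simp only [DualOrlicz.radialFn_unitBody]
  · rintro ⟨K, h0, hK⟩ ξ
    -- Division by `⊤` gives `0` in `ℝ≥0∞`, whereas the normalized measure of the whole sphere is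
    -- `1`.
    have hV : DualOrlicz.dualQuermass φ K ≠ ⊤ := by
      intro htop
      have h1 := hK univ MeasurableSet.univ
      rw [htop, ENNReal.div_top, ENNReal.div_self hμuniv (measure_ne_top _ _)] at h1
      exact one_ne_zero h1
    have hc := DualOrlicz.continuous_max_inner (ξ : DualOrlicz.E n)
    have hη : MeasurableSet {v : DualOrlicz.S n | 0 < ⟪(ξ : DualOrlicz.E n), (v : DualOrlicz.E n)⟫} :=
      (isOpen_lt continuous_const (by fun_prop)).measurableSet
    have hpos : 0 < μ {v : DualOrlicz.S n | 0 < ⟪(ξ : DualOrlicz.E n), (v : DualOrlicz.E n)⟫} := by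
      refine pos_iff_ne_zero.2 fun hzero => ?_
      have h1 := hK _ hη
      rw [hzero, ENNReal.zero_div, eq_comm, ENNReal.div_eq_zero_iff] at h1
      exact h1.elim (DualOrlicz.dualCurvature_openHemisphere_pos hφ h0 ξ).ne' hV
    refine (integral_pos_iff_support_of_nonneg (fun v : DualOrlicz.S n => le_max_right _ (0 : ℝ))
      (DualOrlicz.integrable_of_continuous hc)).2 ?_
    refine hpos.trans_le (measure_mono fun v hv => ?_)
    exact (lt_max_of_lt_left hv).ne'
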